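/- Let $n\ge 1$ and let $\mu=\bigotimes_{i=1}^n\mu_i$, where $\mu_1,\dots,\mu_n$ are non-negative, non-atomic Radon measures on $\mathbb R$. Below, a box is a bounded rectangular parallelepiped in $\mathbb R^n$ with sides parallel to the coordinate axes. For a function $f$ on $\mathbb R^n$ let $$\mathsf M_s^\mu f(x)=\sup_{R\ni x,\ \mu(R)>0}\frac1{\mu(R)}\int_R|f|\,d\mu$$ be the strong maximal function, the supremum being over boxes $R$. For a weight $w$, that is, a non-negative function on $\mathbb R^n$ which is locally integrable with respect to $\mu$, let $$(w)_{A_\infty^*(\mu)}=\sup_{R:\ \mu(R)>0}\frac1{\int_R w\,d\mu}\int_R\mathsf M_s^\mu(w\mathbf 1_R)\,d\mu ,$$ the supremum being over boxes $R$ and $0/0$ being read as $0$, and write $w\in A_\infty^*(\mu)$ if this quantity is finite. Let $w\in A_\infty^*(\mu)$ with $(w)_{A_\infty^*(\mu)}\le\delta$ for some real $\delta\ge1$. Then for every box $R$ with $\mu(R)>0$ and every real $r$ with $1\le r<1+\frac1{2^n(\delta-1)}$ we have $$\frac1{\mu(R)}\int_R w^r\,d\mu\ \le\ \delta\,\frac{r'-1}{r'-1-2^n(\delta-1)}\Big(\frac1{\mu(R)}\int_R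 w\,d\mu\Big)^r ,$$ where $1/r+1/r'=1$. Here $\frac1{2^n(\delta-1)}=\infty$ if $\delta=1$, and for $r=1$ (so $r'=\infty$) the fraction on the right is read as its limit $1$. -/

import Mathlib

open MeasureTheory
open scoped ENNReal

/-- A bounded rectangular parallelepiped in `ℝⁿ` with sides parallel to the coordinate axes:
a product of bounded intervals, each of which may be open, closed or half-open. -/
def IsBox {n : ℕ} (R : Set (Fin n → ℝ)) : Prop :=
  ∃ J : Fin n → Set ℝ,
    (∀ i, (J i).OrdConnected ∧ Bornology.IsBounded (J i)) ∧ R = Set.univ.pi J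

/-- The strong maximal function of `f` with respect to `μ`: the supremum of the `μ`-averages of
`|f|` over the axis-parallel boxes `R ∋ x` with `μ(R) > 0`. -/
noncomputable def strongMaximal {n : ℕ} (μ : Measure (Fin n → ℝ)) (f : (Fin n → ℝ) → ℝ)
    (x : Fin n → ℝ) : ℝ≥0∞ :=
  ⨆ (R : Set (Fin n → ℝ)) (_ : IsBox R) (_ : x ∈ R) (_ : 0 < μ R), ⨍⁻ y in R, ‖f y‖ₑ ∂μ

/-- The Fujii-Wilson constant of a non-negative function `w` with respect to `μ` and the basis of
axis-parallel boxes (with the convention `0 / 0 = 0` on boxes where `w` vanishes almost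
everywhere). -/
noncomputable def strongAInftyConst {n : ℕ} (μ : Measure (Fin n → ℝ)) (w : (Fin n → ℝ) → ℝ) :
    ℝ≥0∞ :=
  ⨆ (R : Set (Fin n → ℝ)) (_ : IsBox R) (_ : 0 < μ R),
    (∫⁻ x in R, strongMaximal μ (R.indicator w) x ∂μ) / ∫⁻ x in R, ENNReal.ofReal (w x) ∂μ

/-- The class of strong (multiparameter) `A_∞` weights with respect to `μ`. A weight is a
non-negative locally integrable function. -/
structure MemStrongAInfty {n : ℕ} (μ : Measure (Fin n → ℝ)) (w : (Fin n → ℝ) → ℝ) : Prop where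
  nonneg : ∀ x, 0 ≤ w x
  locallyIntegrable : LocallyIntegrable w μ
  const_lt_top : strongAInftyConst μ w < ∞

/-- The constant `δ (r' - 1) / (r' - 1 - 2ⁿ (δ - 1))`, where `r' = r / (r - 1)` is the dual exponent
of `r`. For `r = 1`, when `r' = ∞`, the quotient is `1`, its limit as `r' → ∞`. -/
noncomputable def reverseHolderConst (n : ℕ) (δ r : ℝ) : ℝ :=
  if r = 1 then δ
  else δ * ((r.conjExponent - 1) / (r.conjExponent - 1 - 2 ^ n * (δ - 1)))

/-! Normalise the measure on `R` to a product of probability measures `ν i` without atoms. The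
distribution function of `ν i` carries it to the uniform law, so pulling back dyadic intervals
splits space into nested cells of mass exactly `2 ^ (-kn)`; intersected with `R` they are boxes, and
a parent has `2 ^ n` times the mass of its child. Let `M` be the maximal function over cells of
generation at most `K`. The Fujii-Wilson condition bounds the integral over any cell of its
localised maximal function by `δ ∫ w`. Applied to the parent of a cell selected by stopping at
height `t`, and summed, it gives `∫_{M > t} M ≤ (1 + c) t P(M > t)` with `c = 2 ^ n (δ - 1)`
(`setLIntegral_cellMaximal_cell_le`, `setLIntegral_superlevel_cellMaximal_le`). The layer-cake
formula turns this into a bound for `∫ M ^ r` (`lintegral_rpow_le_of_superlevel`). It is uniform in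
`K`, and `w ≤ sup_K M` almost everywhere by martingale convergence (`ae_le_iSup_cellAverage`), so
monotone convergence finishes. -/

/-! ### Dyadic partitions of the line adapted to a measure without atoms. -/

open ProbabilityTheory Set Filter Topology in
theorem continuous_cdf_of_nullSingletonClass (ν : Measure ℝ) [IsProbabilityMeasure ν]
    [NullSingletonClass ν] : Continuous (cdf ν) := by
  rw [continuous_iff_continuousAt]
  intro x
  rw [(cdf ν).mono.continuousAt_iff_leftLim_eq_rightLim, (cdf ν).rightLim_eq]
  have h : (cdf ν).measure {x} = 0 := by rw [measure_cdf, measure_singleton]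
  rw [StieltjesFunction.measure_singleton, ENNReal.ofReal_eq_zero] at h
  exact le_antisymm ((cdf ν).mono.leftLim_le le_rfl) (by linarith)

-- For `t > 0` the set is closed, bounded below and upward closed, hence a half-line `[a, ∞)`, and
-- continuity forces the distribution function to equal `t` at `a`.
open ProbabilityTheory Set Filter Topology in
theorem measureReal_le_cdf (ν : Measure ℝ) [IsProbabilityMeasure ν]
    [NullSingletonClass ν] {t : ℝ} (h0 : 0 ≤ t) (h1 : t < 1) :
    ν.real {x | t ≤ cdf ν x} = 1 - t := by
  rcases h0.eq_or_lt with rfl | h0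
  · have : {x | 0 ≤ cdf ν x} = univ := by ext x; simp [cdf_nonneg]
    simp [this]
  have hc := continuous_cdf_of_nullSingletonClass ν
  obtain ⟨y, hy⟩ := ((tendsto_cdf_atTop ν).eventually (lt_mem_nhds h1)).exists
  obtain ⟨z, hz⟩ := ((tendsto_cdf_atBot ν).eventually (gt_mem_nhds h0)).exists
  set S := {x | t ≤ cdf ν x} with hS
  have hcl : IsClosed S := isClosed_le continuous_const hc
  have hbdd : BddBelow S := ⟨z, fun x hx => by
    by_contra! h
    exact absurd ((cdf ν).mono h.le) (not_le.2 (hz.trans_le hx))⟩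
  have hmem : sInf S ∈ S := hcl.csInf_mem ⟨y, hy.le⟩ hbdd
  set a := sInf S
  have hSa : S = Ici a := by
    ext x
    exact ⟨fun hx => csInf_le hbdd hx, fun hx => le_trans hmem ((cdf ν).mono hx)⟩
  have hle : cdf ν a ≤ t := by
    refine le_of_tendsto (x := 𝓝[<] a) (hc.continuousAt.tendsto.mono_left nhdsWithin_le_nhds) ?_
    filter_upwards [self_mem_nhdsWithin] with x hx
    by_contra! h
    exact absurd (csInf_le hbdd h.le) (not_le.2 hx)
  have hat : cdf ν a = t := le_antisymm hle hmem
  rw [hSa, measureReal_congr Ioi_ae_eq_Ici.symm, ← compl_Iic,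
    measureReal_compl measurableSet_Iic, ← cdf_eq_real, hat, probReal_univ]

/-- The index of the dyadic interval of generation `k` that contains the value at `x` of the
distribution function of `ν`; the last of these intervals is closed. -/
noncomputable def dyadicIndex (ν : Measure ℝ) (k : ℕ) (x : ℝ) : ℕ :=
  min ⌊2 ^ k * ProbabilityTheory.cdf ν x⌋₊ (2 ^ k - 1)

theorem dyadicIndex_mono (ν : Measure ℝ) (k : ℕ) : Monotone (dyadicIndex ν k) := by
  intro x y h
  have := (ProbabilityTheory.cdf ν).mono h
  unfold dyadicIndex
  gcongr

@[simp]
theorem dyadicIndex_zero (ν : Measure ℝ) (x : ℝ) : dyadicIndex ν 0 x = 0 := by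
  simp [dyadicIndex]

/-- Makes the partitions nested: floors are compatible with halving, and the cap `2 ^ (k + 1) - 1`
halves to `2 ^ k - 1`. -/
theorem dyadicIndex_succ_div_two (ν : Measure ℝ) (k : ℕ) (x : ℝ) :
    dyadicIndex ν (k + 1) x / 2 = dyadicIndex ν k x := by
  have h : ⌊2 ^ k * ProbabilityTheory.cdf ν x⌋₊
      = ⌊2 ^ (k + 1) * ProbabilityTheory.cdf ν x⌋₊ / 2 := by
    rw [← Nat.floor_div_ofNat]
    congr 1
    ring
  have hp : 1 ≤ 2 ^ k := Nat.one_le_two_pow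
  unfold dyadicIndex
  rw [h, pow_succ 2 k]
  omega

open ProbabilityTheory in
theorem measureReal_le_dyadicIndex (ν : Measure ℝ) [IsProbabilityMeasure ν]
    [NullSingletonClass ν] (k j : ℕ) (hj : j ≤ 2 ^ k) :
    ν.real {x | j ≤ dyadicIndex ν k x} = 1 - j / 2 ^ k := by
  have hp : 1 ≤ 2 ^ k := Nat.one_le_two_pow
  have hp' : (0 : ℝ) < 2 ^ k := by positivity
  rcases hj.lt_or_eq with hj | rfl
  · have : {x | j ≤ dyadicIndex ν k x} = {x | (j : ℝ) / 2 ^ k ≤ cdf ν x} := by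
      ext x
      have h1 : j ≤ 2 ^ k - 1 := by omega
      simp only [Set.mem_ofPred_eq, dyadicIndex, le_min_iff, h1, and_true]
      rw [Nat.le_floor_iff (mul_nonneg hp'.le (cdf_nonneg ν x)), div_le_iff₀' hp']
    rw [this, measureReal_le_cdf ν (by positivity)]
    rw [div_lt_one hp']
    exact_mod_cast hj
  -- The cap matters here: points where the distribution function is `1` stay in the last cell, so
  -- no null cell arises.
  · have : {x | 2 ^ k ≤ dyadicIndex ν k x} = ∅ := by
      ext x
      simp only [Set.mem_ofPred_eq, Set.mem_empty_iff_false, iff_false, not_le]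
      exact (min_le_right _ _).trans_lt (by omega)
    simp [this]

theorem measureReal_dyadicIndex_eq (ν : Measure ℝ) [IsProbabilityMeasure ν]
    [NullSingletonClass ν] (k : ℕ) (x : ℝ) :
    ν.real {y | dyadicIndex ν k y = dyadicIndex ν k x} = (2 ^ k)⁻¹ := by
  have hp : 1 ≤ 2 ^ k := Nat.one_le_two_pow
  set j := dyadicIndex ν k x with hj
  have hj' : j + 1 ≤ 2 ^ k := by
    have : j ≤ 2 ^ k - 1 := min_le_right _ _
    omega
  have : {y | dyadicIndex ν k y = j}
      = {y | j ≤ dyadicIndex ν k y} \ {y | j + 1 ≤ dyadicIndex ν k y} := by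
    ext y
    simp only [Set.mem_ofPred_eq, Set.mem_sdiff]
    omega
  have hm : MeasurableSet {y | j + 1 ≤ dyadicIndex ν k y} :=
    (dyadicIndex_mono ν k).measurable measurableSet_Ici
  have hs : {y | j + 1 ≤ dyadicIndex ν k y} ⊆ {y | j ≤ dyadicIndex ν k y} :=
    fun y hy => (Nat.le_succ j).trans hy
  rw [this, measureReal_sdiff hs hm,
    measureReal_le_dyadicIndex ν k j (by omega), measureReal_le_dyadicIndex ν k _ hj']
  push_cast
  ring

theorem measure_dyadicIndex_eq (ν : Measure ℝ) [IsProbabilityMeasure ν]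
    [NullSingletonClass ν] (k : ℕ) (x : ℝ) :
    ν {y | dyadicIndex ν k y = dyadicIndex ν k x} = (2 ^ k)⁻¹ := by
  rw [← ofReal_measureReal, measureReal_dyadicIndex_eq,
    ENNReal.ofReal_inv_of_pos (by positivity), ENNReal.ofReal_pow (by norm_num)]
  norm_num

-- The excess of the right side over the half-line lies, for every `k`, in the cell of `a`, whose
-- mass is `2 ^ (-k)`.
open Filter Topology in
theorem Iic_ae_eq_iInter_dyadicIndex (ν : Measure ℝ) [IsProbabilityMeasure ν]
    [NullSingletonClass ν] (a : ℝ) :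
    (Set.Iic a : Set ℝ) =ᵐ[ν] ⋂ k, dyadicIndex ν k ⁻¹' Set.Iic (dyadicIndex ν k a) := by
  have hsub : (Set.Iic a : Set ℝ) ⊆ ⋂ k, dyadicIndex ν k ⁻¹' Set.Iic (dyadicIndex ν k a) :=
    fun x hx => Set.mem_iInter.2 fun k => dyadicIndex_mono ν k hx
  refine LE.le.eventuallyLE hsub |>.antisymm (ae_le_set.2 ?_)
  have hle : ∀ k, ν ((⋂ k, dyadicIndex ν k ⁻¹' Set.Iic (dyadicIndex ν k a)) \ Set.Iic a)
      ≤ (2 : ℝ≥0∞)⁻¹ ^ k := by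
    intro k
    rw [← ENNReal.inv_pow, ← measure_dyadicIndex_eq ν k a]
    refine measure_mono fun y hy => ?_
    have h1 := Set.mem_iInter.1 hy.1 k
    exact le_antisymm h1 (dyadicIndex_mono ν k (not_le.1 hy.2).le)
  have := ge_of_tendsto' (ENNReal.tendsto_pow_atTop_nhds_zero_of_lt_one
    (by rw [ENNReal.inv_lt_one]; norm_num : (2 : ℝ≥0∞)⁻¹ < 1)) hle
  exact le_antisymm this bot_le

/-! ### From super-level sets to higher integrability. -/

open Set in
theorem lintegral_Ioc_zero_rpow {A p : ℝ} (hA : 0 ≤ A) (hp : 0 < p) :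
    ∫⁻ t in Ioc 0 A, ENNReal.ofReal (t ^ (p - 1)) = ENNReal.ofReal (A ^ p / p) := by
  have hint : IntervalIntegrable (fun t : ℝ => t ^ (p - 1)) volume 0 A :=
    intervalIntegral.intervalIntegrable_rpow' (by linarith)
  rw [← ofReal_integral_eq_lintegral_ofReal, ← intervalIntegral.integral_of_le hA,
    integral_rpow (Or.inl (by linarith))]
  · simp [Real.zero_rpow hp.ne']
  · exact (intervalIntegrable_iff_integrableOn_Ioc_of_le hA).1 hint
  · filter_upwards [ae_restrict_mem measurableSet_Ioc] with t ht
    exact Real.rpow_nonneg ht.1.le _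

open Set in
/-- A bounded function whose super-level sets satisfy the good-`λ` type inequality
`∫_{M > t} M ≤ (1 + c) t P(M > t)` above its lower bound `A` has higher integrability. -/
theorem lintegral_rpow_le_of_superlevel {Ω : Type*} [MeasurableSpace Ω] (P : Measure Ω)
    [IsProbabilityMeasure P] {M : Ω → ℝ} (hM : Measurable M) {A B c δ ε : ℝ} (hA : 0 ≤ A)
    (hAM : ∀ x, A ≤ M x) (hMB : ∀ x, M x ≤ B) (hε : 0 < ε) (hc : 0 ≤ c) (hεc : ε * c < 1)
    (hδ : 1 ≤ δ) (hδc : δ - 1 ≤ c) (h1 : ∫⁻ x, ENNReal.ofReal (M x) ∂P ≤ ENNReal.ofReal (δ * A))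
    (h2 : ∀ t, A ≤ t → ∫⁻ x in {x | t < M x}, ENNReal.ofReal (M x) ∂P
      ≤ ENNReal.ofReal ((1 + c) * t) * P {x | t < M x}) :
    ∫⁻ x, ENNReal.ofReal (M x ^ (1 + ε)) ∂P ≤
      ENNReal.ofReal (δ / (1 - ε * c) * A ^ (1 + ε)) := by
  have hM0 : ∀ x, 0 ≤ M x := fun x => hA.trans (hAM x)
  set F := ∫⁻ x, ENNReal.ofReal (M x ^ (1 + ε)) ∂P with hF
  set Y := ∫⁻ t in Ioi A, P {x | t < M x} * ENNReal.ofReal (t ^ ε) with hY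
  have hsplit : ∀ f : ℝ → ℝ≥0∞,
      ∫⁻ t in Ioi 0, f t = (∫⁻ t in Ioc 0 A, f t) + ∫⁻ t in Ioi A, f t := by
    intro f
    rw [← lintegral_union measurableSet_Ioi, Ioc_union_Ioi_eq_Ioi hA]
    exact disjoint_left.2 fun t ht ht' => not_lt.2 ht.2 ht'
  -- The upper bound `B` does not enter the estimate; it only ensures finiteness, so that `Y` can be
  -- eliminated at the end.
  have hFtop : F ≠ ∞ := by
    refine ((lintegral_mono fun x => ENNReal.ofReal_le_ofReal
      (Real.rpow_le_rpow (hM0 x) (hMB x) (by linarith))).trans_lt ?_).ne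
    simp
  have hFY : F = ENNReal.ofReal (A ^ (1 + ε)) + ENNReal.ofReal (1 + ε) * Y := by
    rw [hF, lintegral_rpow_eq_lintegral_meas_lt_mul P (Filter.Eventually.of_forall hM0)
      hM.aemeasurable (by linarith), hsplit, mul_add]
    simp only [add_sub_cancel_left]
    congr 1
    have : ∫⁻ t in Ioc 0 A, P {x | t < M x} * ENNReal.ofReal (t ^ ε)
        = ∫⁻ t in Ioc 0 A, ENNReal.ofReal (t ^ ((1 + ε) - 1)) := by
      -- The endpoint `t = A` is dropped because `A < M x` may fail there.
      rw [← restrict_Ioo_eq_restrict_Ioc]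
      refine setLIntegral_congr_fun measurableSet_Ioo fun t ht => ?_
      have hu : {x | t < M x} = univ := by
        ext x
        simpa using ht.2.trans_le (hAM x)
      simp [hu]
    rw [this, lintegral_Ioc_zero_rpow hA (by linarith), ← ENNReal.ofReal_mul (by linarith)]
    congr 1
    field_simp
  have hYtop : Y ≠ ∞ := by
    intro h
    rw [h, ENNReal.mul_top (by simp; linarith)] at hFY
    simp [hFY] at hFtop
  have hFle : F ≤ ENNReal.ofReal (δ * A ^ (1 + ε)) + ENNReal.ofReal (ε * (1 + c)) * Y := by
    -- A second layer-cake formula, for `M ^ ε` against `M dP`: its level masses are the integrals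
    -- bounded by `h1` and `h2`.
    set ν := P.withDensity fun x => ENNReal.ofReal (M x) with hν
    have hFν : F = ∫⁻ x, ENNReal.ofReal (M x ^ ε) ∂ν := by
      rw [hν, lintegral_withDensity_eq_lintegral_mul _ hM.ennreal_ofReal
        (hM.pow_const ε).ennreal_ofReal]
      refine lintegral_congr fun x => ?_
      rw [Pi.mul_apply, ← ENNReal.ofReal_mul (hM0 x), Real.rpow_add_of_nonneg (hM0 x) zero_le_one
        hε.le, Real.rpow_one]
    have hνt : ∀ t, ν {x | t < M x} = ∫⁻ x in {x | t < M x}, ENNReal.ofReal (M x) ∂P :=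
      fun t => withDensity_apply _ (measurableSet_lt measurable_const hM)
    have hνuniv : ν univ ≤ ENNReal.ofReal (δ * A) := by
      rwa [hν, withDensity_apply _ MeasurableSet.univ, setLIntegral_univ]
    rw [hFν, lintegral_rpow_eq_lintegral_meas_lt_mul ν (Filter.Eventually.of_forall hM0)
      hM.aemeasurable hε, hsplit,
      mul_add (ENNReal.ofReal ε)]
    refine add_le_add ?_ ?_
    · calc ENNReal.ofReal ε * ∫⁻ t in Ioc 0 A, ν {x | t < M x} * ENNReal.ofReal (t ^ (ε - 1))
          ≤ ENNReal.ofReal ε * ∫⁻ t in Ioc 0 A,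
              ENNReal.ofReal (δ * A) * ENNReal.ofReal (t ^ (ε - 1)) := by
            gcongr
            exact (measure_mono (subset_univ _)).trans hνuniv
        _ = ENNReal.ofReal (δ * A ^ (1 + ε)) := by
            rw [lintegral_const_mul' _ _ ENNReal.ofReal_ne_top, lintegral_Ioc_zero_rpow hA hε,
              ← ENNReal.ofReal_mul (by positivity), ← ENNReal.ofReal_mul hε.le,
              Real.rpow_add_of_nonneg hA zero_le_one hε.le, Real.rpow_one]
            congr 1
            field_simp
    · rw [ENNReal.ofReal_mul hε.le, mul_assoc]
      gcongr
      rw [hY, ← lintegral_const_mul' _ _ ENNReal.ofReal_ne_top]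
      refine setLIntegral_mono' measurableSet_Ioi fun t ht => ?_
      have ht0 : 0 < t := hA.trans_lt ht
      rw [hνt]
      calc _ ≤ ENNReal.ofReal ((1 + c) * t) * P {x | t < M x} * ENNReal.ofReal (t ^ (ε - 1)) := by
            gcongr
            exact h2 t (le_of_lt ht)
        _ = _ := by
            have : t ^ ε = t * t ^ (ε - 1) := by
              rw [← Real.rpow_one_add' ht0.le (by linarith)]
              congr 1
              ring
            rw [this, ENNReal.ofReal_mul (by linarith), ENNReal.ofReal_mul ht0.le]
            ring
  have hA' : 0 ≤ A ^ (1 + ε) := Real.rpow_nonneg hA _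
  clear_value F Y
  lift Y to NNReal using hYtop
  have e1 : F = ENNReal.ofReal (A ^ (1 + ε) + (1 + ε) * Y) := by
    rw [hFY, ENNReal.ofReal_add hA' (by positivity), ENNReal.ofReal_mul (by positivity),
      ENNReal.ofReal_coe_nnreal]
  have e2 : ENNReal.ofReal (δ * A ^ (1 + ε)) + ENNReal.ofReal (ε * (1 + c)) * Y
      = ENNReal.ofReal (δ * A ^ (1 + ε) + ε * (1 + c) * Y) := by
    rw [ENNReal.ofReal_add (by positivity) (by positivity), ENNReal.ofReal_mul (by positivity),
      ENNReal.ofReal_mul (by positivity) (q := (Y : ℝ)), ENNReal.ofReal_coe_nnreal]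
  rw [e1, e2, ENNReal.ofReal_le_ofReal_iff (by positivity)] at hFle
  rw [e1]
  refine ENNReal.ofReal_le_ofReal ?_
  have hd : 0 < 1 - ε * c := by linarith
  rw [div_mul_eq_mul_div, le_div_iff₀ hd]
  -- Comparing the two formulas gives `(1 - εc) Y ≤ (δ - 1) A ^ (1 + ε)`. Hence `(1 - εc) F ≤ (δ + ε
  -- (δ - 1 - c)) A ^ (1 + ε)`, and `δ - 1 ≤ c`.
  nlinarith [mul_nonneg (mul_nonneg hε.le (sub_nonneg.2 hδc)) hA']

/-! ### Maximal functions of nested partitions and stopping cells. -/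

/-- The average of `w` over the cell `{y | c k y = c k x}` of the partition of generation `k`. -/
noncomputable def cellAverage {Ω ι : Type*} [MeasurableSpace Ω] (P : Measure Ω) (c : ℕ → Ω → ι)
    (w : Ω → ℝ≥0∞) (k : ℕ) (x : Ω) : ℝ≥0∞ :=
  ⨍⁻ y in {y | c k y = c k x}, w y ∂P

theorem index_eq_of_le {Ω ι : Type*} {c : ℕ → Ω → ι}
    (hnest : ∀ k x y, c (k + 1) x = c (k + 1) y → c k x = c k y)
    {j k : ℕ} (hjk : j ≤ k) {x y : Ω} (h : c k x = c k y) : c j x = c j y := by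
  induction hjk with
  | refl => exact h
  | step _ ih => exact ih (hnest _ _ _ h)

/-- The maximal function associated with the cells of the generations `j, …, K`. -/
noncomputable def cellMaximal {Ω ι : Type*} [MeasurableSpace Ω] (P : Measure Ω) (c : ℕ → Ω → ι)
    (w : Ω → ℝ≥0∞) (j K : ℕ) (x : Ω) : ℝ≥0∞ :=
  (Finset.Icc j K).sup fun i => cellAverage P c w i x

section Partitions

variable {Ω ι : Type*} [MeasurableSpace Ω] {P : Measure Ω} {c : ℕ → Ω → ι} {w : Ω → ℝ≥0∞}

theorem cellAverage_congr {k : ℕ} {x y : Ω} (h : c k x = c k y) :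
    cellAverage P c w k x = cellAverage P c w k y := by
  simp [cellAverage, h]

theorem setLIntegral_cell [IsFiniteMeasure P] (k : ℕ) (x : Ω)
    (hpos : P {y | c k y = c k x} ≠ 0) :
    ∫⁻ y in {y | c k y = c k x}, w y ∂P
      = cellAverage P c w k x * P {y | c k y = c k x} := by
  rw [cellAverage, setLAverage_eq, ENNReal.div_mul_cancel hpos (measure_ne_top _ _)]

variable [MeasurableSpace ι] [MeasurableSingletonClass ι]

theorem measurableSet_cell (hc : ∀ k, Measurable (c k)) (k : ℕ) (x : Ω) :
    MeasurableSet {y | c k y = c k x} :=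
  hc k (measurableSet_singleton (c k x))

/-- Apply the hypothesis to the parent `C` of the cell `Q`. Off `Q` the maximal function is at least
the average `a` over `C`, so subtracting `a P(C \ Q)` leaves `a P(Q) + η a P(C)`. Thus `D`
multiplies only the excess `η`. -/
theorem setLIntegral_cellMaximal_cell_le [IsFiniteMeasure P] (hc : ∀ k, Measurable (c k))
    (hnest : ∀ k x y, c (k + 1) x = c (k + 1) y → c k x = c k y)
    (hpos : ∀ k x, P {y | c k y = c k x} ≠ 0) {D η : ℝ≥0∞}
    (hD : ∀ k x, P {y | c k y = c k x} ≤ D * P {y | c (k + 1) y = c (k + 1) x})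
    (hη : ∀ j K x, ∫⁻ y in {y | c j y = c j x}, cellMaximal P c w j K y ∂P
      ≤ (1 + η) * ∫⁻ y in {y | c j y = c j x}, w y ∂P)
    {t : ℝ≥0∞} (ht : t ≠ ∞) {k K : ℕ} {x : Ω} (hk : k + 1 ≤ K)
    (hx : cellAverage P c w k x ≤ t) :
    ∫⁻ y in {y | c (k + 1) y = c (k + 1) x}, cellMaximal P c w (k + 1) K y ∂P
      ≤ (1 + D * η) * t * P {y | c (k + 1) y = c (k + 1) x} := by
  set Q := {y | c (k + 1) y = c (k + 1) x} with hQ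
  set C := {y | c k y = c k x} with hC
  set a := cellAverage P c w k x with ha
  have hQC : Q ⊆ C := fun y hy => hnest k y x hy
  have hQm : MeasurableSet Q := measurableSet_cell hc _ x
  have hCm : MeasurableSet C := measurableSet_cell hc _ x
  have hPC : P C = P Q + P (C \ Q) := by
    rw [← measure_inter_add_sdiff C hQm, Set.inter_eq_right.2 hQC]
  have hatop : a ≠ ∞ := ne_top_of_le_ne_top ht hx
  have key : ∫⁻ y in Q, cellMaximal P c w (k + 1) K y ∂P + a * P (C \ Q)
      ≤ (1 + η) * (a * P C) := by
    calc ∫⁻ y in Q, cellMaximal P c w (k + 1) K y ∂P + a * P (C \ Q)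
        ≤ ∫⁻ y in Q, cellMaximal P c w k K y ∂P + ∫⁻ y in C \ Q, cellMaximal P c w k K y ∂P := by
          refine add_le_add (lintegral_mono fun y => ?_) ?_
          · exact Finset.sup_mono (Finset.Icc_subset_Icc_left (Nat.le_succ k))
          · rw [← setLIntegral_const]
            refine setLIntegral_mono' (hCm.diff hQm) fun y hy => ?_
            rw [ha, ← cellAverage_congr (k := k) (show c k y = c k x from hy.1)]
            exact Finset.le_sup (f := fun i => cellAverage P c w i y)
              (Finset.mem_Icc.2 ⟨le_rfl, by omega⟩)
      _ = ∫⁻ y in C, cellMaximal P c w k K y ∂P := by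
          rw [← lintegral_inter_add_sdiff _ C hQm, Set.inter_eq_right.2 hQC]
      _ ≤ _ := by
          rw [← setLIntegral_cell k x (hpos k x)]
          exact hη k K x
  refine ENNReal.le_of_add_le_add_right
    (ENNReal.mul_ne_top hatop (measure_ne_top P (C \ Q))) (key.trans ?_)
  calc (1 + η) * (a * P C) = a * P Q + η * a * P C + a * P (C \ Q) := by rw [hPC]; ring
    _ ≤ t * P Q + η * t * (D * P Q) + a * P (C \ Q) := by
        gcongr
        exact hD k x
    _ = _ := by ring

variable [Countable ι]

theorem measurable_cellAverage (hc : ∀ k, Measurable (c k)) (k : ℕ) :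
    Measurable (cellAverage P c w k) := by
  have : cellAverage P c w k = (fun i => ⨍⁻ y in {y | c k y = i}, w y ∂P) ∘ c k := rfl
  rw [this]
  exact (measurable_of_countable _).comp (hc k)

/-- An inequality between integrals holds on a union of cells if it holds on each of them. -/
theorem setLIntegral_le_mul_measure_of_cells {g : Ω → ℝ≥0∞} (b : ℝ≥0∞) {κ : Ω → ι}
    (hκ : Measurable κ) {E : Set Ω} (hE : ∀ x ∈ E, ∀ y, κ y = κ x → y ∈ E)
    (h : ∀ x ∈ E, ∫⁻ y in {y | κ y = κ x}, g y ∂P ≤ b * P {y | κ y = κ x}) :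
    ∫⁻ y in E, g y ∂P ≤ b * P E := by
  have hEU : E = ⋃ i ∈ κ '' E, κ ⁻¹' {i} := by
    ext y
    simp only [Set.mem_iUnion, Set.mem_preimage, Set.mem_singleton_iff, exists_prop,
      exists_eq_right']
    constructor
    · exact fun hy => Set.mem_image_of_mem κ hy
    · rintro ⟨x, hx, hxy⟩
      exact hE x hx y hxy.symm
  have hdisj : (κ '' E).PairwiseDisjoint fun i => κ ⁻¹' {i} := fun i _ j _ hij =>
    Set.disjoint_left.2 fun y hi hj => hij (hi.symm.trans hj)
  have hmeas : ∀ i ∈ κ '' E, MeasurableSet (κ ⁻¹' {i}) := fun i _ =>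
    hκ (measurableSet_singleton i)
  rw [hEU, lintegral_biUnion (Set.to_countable _) hmeas hdisj,
    measure_biUnion (Set.to_countable _) hdisj hmeas, ← ENNReal.tsum_mul_left]
  refine ENNReal.tsum_le_tsum fun i => ?_
  obtain ⟨_, x, hx, rfl⟩ := i
  exact h x hx

theorem measurable_cellMaximal (hc : ∀ k, Measurable (c k)) (j K : ℕ) :
    Measurable (cellMaximal P c w j K) := by
  unfold cellMaximal
  simp only [Finset.sup_eq_iSup]
  exact Measurable.iSup fun i => Measurable.iSup fun _ => measurable_cellAverage hc i

/-- The super-level sets of the maximal function decompose into stopping cells. -/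
theorem setLIntegral_superlevel_cellMaximal_le [IsFiniteMeasure P] (hc : ∀ k, Measurable (c k))
    (hnest : ∀ k x y, c (k + 1) x = c (k + 1) y → c k x = c k y)
    (hpos : ∀ k x, P {y | c k y = c k x} ≠ 0) {D η : ℝ≥0∞}
    (hD : ∀ k x, P {y | c k y = c k x} ≤ D * P {y | c (k + 1) y = c (k + 1) x})
    (hη : ∀ j K x, ∫⁻ y in {y | c j y = c j x}, cellMaximal P c w j K y ∂P
      ≤ (1 + η) * ∫⁻ y in {y | c j y = c j x}, w y ∂P)
    {t : ℝ≥0∞} (ht : t ≠ ∞) (K : ℕ) (h0 : ∀ x, cellAverage P c w 0 x ≤ t) :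
    ∫⁻ x in {x | t < cellMaximal P c w 0 K x}, cellMaximal P c w 0 K x ∂P
      ≤ (1 + D * η) * t * P {x | t < cellMaximal P c w 0 K x} := by
  -- `E k` collects the points whose averages first exceed `t` at generation `k`; it is a union of
  -- cells of that generation.
  set E : ℕ → Set Ω := fun k =>
    {x | t < cellAverage P c w k x ∧ ∀ i < k, cellAverage P c w i x ≤ t} with hE
  have hEcell : ∀ k, ∀ x ∈ E k, ∀ y, c k y = c k x → y ∈ E k := by
    intro k x hx y hy
    refine ⟨by rw [cellAverage_congr hy]; exact hx.1, fun i hi => ?_⟩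
    rw [cellAverage_congr (index_eq_of_le hnest hi.le hy)]
    exact hx.2 i hi
  have hEm : ∀ k, MeasurableSet (E k) := by
    intro k
    refine (measurableSet_lt measurable_const (measurable_cellAverage hc k)).inter ?_
    have : {x | ∀ i < k, cellAverage P c w i x ≤ t}
        = ⋂ i, ⋂ _ : i < k, {x | cellAverage P c w i x ≤ t} := by
      ext x; simp
    change MeasurableSet {x | ∀ i < k, cellAverage P c w i x ≤ t}
    rw [this]
    exact MeasurableSet.iInter fun i => MeasurableSet.iInter fun _ =>
      measurableSet_le (measurable_cellAverage hc i) measurable_const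
  have hdisj : (↑(Finset.range (K + 1)) : Set ℕ).PairwiseDisjoint E := by
    intro i _ j _ hij
    refine Set.disjoint_left.2 fun x hi hj => ?_
    rcases hij.lt_or_gt with h | h
    · exact not_lt.2 (hj.2 i h) hi.1
    · exact not_lt.2 (hi.2 j h) hj.1
  have hU : {x | t < cellMaximal P c w 0 K x} = ⋃ k ∈ Finset.range (K + 1), E k := by
    classical
    ext x
    simp only [Set.mem_ofPred_eq, cellMaximal, Finset.lt_sup_iff, Finset.mem_Icc, zero_le,
      true_and, Set.mem_iUnion, Finset.mem_range, exists_prop]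
    constructor
    · rintro ⟨i, hi, hti⟩
      have hex : ∃ i, t < cellAverage P c w i x := ⟨i, hti⟩
      exact ⟨Nat.find hex, Nat.lt_succ_of_le ((Nat.find_min' hex hti).trans hi),
        Nat.find_spec hex, fun j hj => not_lt.1 (Nat.find_min hex hj)⟩
    · rintro ⟨k, hk, hx⟩
      exact ⟨k, Nat.lt_succ_iff.1 hk, hx.1⟩
  rw [hU, lintegral_biUnion_finset hdisj fun k _ => hEm k,
    measure_biUnion_finset hdisj fun k _ => hEm k, Finset.mul_sum]
  refine Finset.sum_le_sum fun k hk => ?_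
  refine setLIntegral_le_mul_measure_of_cells _ (hc k) (hEcell k) fun x hx => ?_
  -- Generation `0` never stops, by `h0`, so every stopping cell has a parent, with average at most
  -- `t`.
  obtain _ | k := k
  · exact absurd (h0 x) (not_le.2 hx.1)
  have hkK : k + 1 ≤ K := Nat.lt_succ_iff.1 (Finset.mem_range.1 hk)
  refine le_trans (le_of_eq ?_) (setLIntegral_cellMaximal_cell_le hc hnest hpos hD hη ht hkK
    (hx.2 k (Nat.lt_succ_self k)))
  -- On a stopping cell the earlier averages are at most `t`, below the current one, and do not
  -- affect the maximum.
  refine setLIntegral_congr_fun (measurableSet_cell hc _ x) fun y hy => ?_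
  have hy' := hEcell _ x hx y hy
  refine le_antisymm (Finset.sup_le fun i hi => ?_)
    (Finset.sup_mono (Finset.Icc_subset_Icc_left (Nat.zero_le _)))
  rcases lt_or_ge i (k + 1) with h | h
  · exact (hy'.2 i h).trans (hy'.1.le.trans (Finset.le_sup
      (f := fun i => cellAverage P c w i y) (Finset.mem_Icc.2 ⟨le_rfl, hkK⟩)))
  · exact Finset.le_sup (f := fun i => cellAverage P c w i y)
      (Finset.mem_Icc.2 ⟨h, (Finset.mem_Icc.1 hi).2⟩)

end Partitions

/-! ### Martingale convergence and the reverse Hölder inequality for cells. -/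

section Partitions

variable {Ω ι : Type*} [MeasurableSpace Ω] {P : Measure Ω} {c : ℕ → Ω → ι} {w : Ω → ℝ≥0∞}
  [Countable ι] [mι : MeasurableSpace ι] [MeasurableSingletonClass ι]

/-- The filtration generated by a sequence of nested partitions. -/
def cellFiltration (hc : ∀ k, Measurable (c k))
    (hnest : ∀ k x y, c (k + 1) x = c (k + 1) y → c k x = c k y) :
    Filtration ℕ ‹MeasurableSpace Ω› where
  seq k := mι.comap (c k)
  mono' := by
    refine monotone_nat_of_le_succ fun k => ?_
    rintro _ ⟨s, -, rfl⟩
    refine ⟨c (k + 1) '' (c k ⁻¹' s), (Set.to_countable _).measurableSet, ?_⟩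
    ext x
    simp only [Set.mem_preimage, Set.mem_image]
    constructor
    · rintro ⟨y, hy, hxy⟩
      rwa [← hnest k y x hxy]
    · exact fun hx => ⟨x, hx, rfl⟩
  le' k := (hc k).comap_le

/-- If the cells generate the σ-algebra up to null sets, then `w` is almost everywhere bounded by
the supremum of its averages over the cells. -/
theorem ae_le_iSup_cellAverage [IsFiniteMeasure P] (hc : ∀ k, Measurable (c k))
    (hnest : ∀ k x y, c (k + 1) x = c (k + 1) y → c k x = c k y)
    (hpos : ∀ k x, P {y | c k y = c k x} ≠ 0)
    (hgen : ∀ s, MeasurableSet s → ∃ t, MeasurableSet[⨆ k, mι.comap (c k)] t ∧ s =ᵐ[P] t)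
    (hw : AEMeasurable w P) (hw' : ∫⁻ x, w x ∂P ≠ ∞) :
    ∀ᵐ x ∂P, w x ≤ ⨆ k, cellAverage P c w k x := by
  set ℱ := cellFiltration hc hnest with hℱ
  set f : Ω → ℝ := fun x => (w x).toReal with hf
  have hwfin : ∀ᵐ x ∂P, w x < ∞ := ae_lt_top' hw hw'
  have hfint : Integrable f P := integrable_toReal_of_lintegral_ne_top hw hw'
  have hle : ⨆ k, ℱ k ≤ ‹MeasurableSpace Ω› := iSup_le ℱ.le
  have hlim : P[f | ⨆ k, ℱ k] =ᵐ[P] f := by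
    refine Integrable.ae_eq_of_forall_setIntegral_eq _ _ integrable_condExp hfint fun s hs _ => ?_
    obtain ⟨t, ht, hst⟩ := hgen s hs
    rw [setIntegral_congr_set hst, setIntegral_congr_set hst]
    exact setIntegral_condExp hle hfint ht
  -- The conditional expectation is constant on each cell, and cells have positive mass, so the
  -- identity holds at every point.
  have havg : ∀ k x, (P[f | ℱ k]) x = (cellAverage P c w k x).toReal := by
    intro k x
    set C := {y | c k y = c k x} with hC
    have hCm : MeasurableSet[ℱ k] C := ⟨{c k x}, measurableSet_singleton _, rfl⟩
    have hfac : ∀ y ∈ C, (P[f | ℱ k]) y = (P[f | ℱ k]) x := fun y hy =>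
      Measurable.factorsThrough (mY := mι) (f := c k)
        (stronglyMeasurable_condExp (m := ℱ k)).measurable hy
    have h1 := setIntegral_condExp (ℱ.le k) hfint hCm
    rw [setIntegral_congr_fun (ℱ.le k _ hCm) hfac, setIntegral_const, hf,
      integral_toReal hw.restrict (ae_restrict_of_ae hwfin), smul_eq_mul] at h1
    have hP : P.real C ≠ 0 := (ENNReal.toReal_pos (hpos k x) (measure_ne_top _ _)).ne'
    rw [cellAverage, setLAverage_eq, ENNReal.toReal_div, ← hC, ← h1]
    exact (mul_div_cancel_left₀ _ hP).symm
  filter_upwards [tendsto_ae_condExp (ℱ := ℱ) f, hlim, hwfin] with x hx hx' hxfin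
  rw [hx'] at hx
  simp only [havg] at hx
  have hx2 := ENNReal.tendsto_ofReal hx
  rw [hf, ENNReal.ofReal_toReal hxfin.ne] at hx2
  refine le_of_tendsto' hx2 fun k => ENNReal.ofReal_toReal_le.trans ?_
  exact le_iSup (fun k => cellAverage P c w k x) k

/-- The reverse Hölder inequality for a weight that satisfies a Fujii-Wilson condition with
respect to the cells of a sequence of nested partitions. -/
theorem lintegral_rpow_le_of_cells [IsProbabilityMeasure P] (hc : ∀ k, Measurable (c k))
    (hc0 : ∀ x y, c 0 x = c 0 y)
    (hnest : ∀ k x y, c (k + 1) x = c (k + 1) y → c k x = c k y)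
    (hpos : ∀ k x, P {y | c k y = c k x} ≠ 0)
    (hgen : ∀ s, MeasurableSet s → ∃ t, MeasurableSet[⨆ k, mι.comap (c k)] t ∧ s =ᵐ[P] t)
    {D δ ε : ℝ} (hD1 : 1 ≤ D) (hδ : 1 ≤ δ) (hε : 0 < ε) (hεD : ε * (D * (δ - 1)) < 1)
    (hD : ∀ k x, P {y | c k y = c k x} ≤ ENNReal.ofReal D * P {y | c (k + 1) y = c (k + 1) x})
    (hδw : ∀ j K x, ∫⁻ y in {y | c j y = c j x}, cellMaximal P c w j K y ∂P
      ≤ ENNReal.ofReal δ * ∫⁻ y in {y | c j y = c j x}, w y ∂P)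
    (hw : AEMeasurable w P) (hw' : ∫⁻ x, w x ∂P ≠ ∞) :
    ∫⁻ x, w x ^ (1 + ε) ∂P ≤
      ENNReal.ofReal (δ / (1 - ε * (D * (δ - 1)))) * (∫⁻ x, w x ∂P) ^ (1 + ε) := by
  set W := ∫⁻ x, w x ∂P with hW
  have hη : 1 + ENNReal.ofReal (δ - 1) = ENNReal.ofReal δ := by
    rw [← ENNReal.ofReal_one, ← ENNReal.ofReal_add zero_le_one (by linarith)]
    congr 1
    ring
  have hcell0 : ∀ x, {y | c 0 y = c 0 x} = Set.univ := fun x => by ext y; simp [hc0 y x]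
  have ha0 : ∀ x, cellAverage P c w 0 x = W := by
    intro x
    rw [cellAverage, hcell0, setLAverage_eq, measure_univ, div_one, setLIntegral_univ]
  -- Iterating `hD` from the single cell of generation `0` bounds cell masses below, hence bounds
  -- the truncated maximal function.
  have hDk : ∀ k x, 1 ≤ ENNReal.ofReal D ^ k * P {y | c k y = c k x} := by
    intro k x
    induction k with
    | zero => simp [hcell0]
    | succ k ih =>
      refine ih.trans ?_
      rw [pow_succ, mul_assoc]
      gcongr
      exact hD k x
  have hD1' : 1 ≤ ENNReal.ofReal D := by simpa using hD1
  have hbound : ∀ K x, cellMaximal P c w 0 K x ≤ ENNReal.ofReal D ^ K * W := by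
    intro K x
    refine Finset.sup_le fun k hk => ?_
    rw [cellAverage, setLAverage_eq]
    refine ENNReal.div_le_of_le_mul ?_
    calc ∫⁻ y in {y | c k y = c k x}, w y ∂P ≤ W * 1 := by
          rw [mul_one]
          exact setLIntegral_le_lintegral _ _
      _ ≤ W * (ENNReal.ofReal D ^ k * P {y | c k y = c k x}) := by
          gcongr
          exact hDk k x
      _ ≤ W * (ENNReal.ofReal D ^ K * P {y | c k y = c k x}) := by
          gcongr
          exact (Finset.mem_Icc.1 hk).2
      _ = _ := by ring
  have hBtop : ∀ K, ENNReal.ofReal D ^ K * W ≠ ∞ := fun K =>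
    ENNReal.mul_ne_top (ENNReal.pow_ne_top ENNReal.ofReal_ne_top) hw'
  have hMtop : ∀ K x, cellMaximal P c w 0 K x ≠ ∞ := fun K x =>
    ne_top_of_le_ne_top (hBtop K) (hbound K x)
  have hWM : ∀ K x, W ≤ cellMaximal P c w 0 K x := fun K x =>
    (ha0 x).symm.le.trans (Finset.le_sup (f := fun i => cellAverage P c w i x) (by simp))
  have hε1 : 0 < 1 + ε := by linarith
  have hd : 0 < 1 - ε * (D * (δ - 1)) := by linarith
  have hK : ∀ K, ∫⁻ x, cellMaximal P c w 0 K x ^ (1 + ε) ∂P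
      ≤ ENNReal.ofReal (δ / (1 - ε * (D * (δ - 1)))) * W ^ (1 + ε) := by
    intro K
    have hM : Measurable fun x => (cellMaximal P c w 0 K x).toReal :=
      (measurable_cellMaximal hc 0 K).ennreal_toReal
    have hofReal : ∀ x, ENNReal.ofReal (cellMaximal P c w 0 K x).toReal
        = cellMaximal P c w 0 K x := fun x => ENNReal.ofReal_toReal (hMtop K x)
    have := lintegral_rpow_le_of_superlevel P hM (A := W.toReal)
      (B := (ENNReal.ofReal D ^ K * W).toReal) (c := D * (δ - 1)) (δ := δ) (ε := ε)
      ENNReal.toReal_nonneg (fun x => ENNReal.toReal_mono (hMtop K x) (hWM K x))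
      (fun x => ENNReal.toReal_mono (hBtop K) (hbound K x)) hε
      (mul_nonneg (by linarith) (by linarith)) hεD hδ
      (le_mul_of_one_le_left (by linarith) hD1) ?_ ?_
    · calc ∫⁻ x, cellMaximal P c w 0 K x ^ (1 + ε) ∂P
          = ∫⁻ x, ENNReal.ofReal ((cellMaximal P c w 0 K x).toReal ^ (1 + ε)) ∂P := by
            refine lintegral_congr fun x => ?_
            rw [← ENNReal.ofReal_rpow_of_nonneg ENNReal.toReal_nonneg hε1.le, hofReal]
        _ ≤ _ := this
        _ = _ := by
            rw [ENNReal.ofReal_mul (by positivity),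
              ← ENNReal.ofReal_rpow_of_nonneg ENNReal.toReal_nonneg hε1.le,
              ENNReal.ofReal_toReal hw']
    · obtain ⟨x⟩ : Nonempty Ω := nonempty_of_isProbabilityMeasure P
      have h := hδw 0 K x
      rw [hcell0, setLIntegral_univ, setLIntegral_univ] at h
      simp only [hofReal]
      rwa [ENNReal.ofReal_mul (by linarith), ENNReal.ofReal_toReal hw']
    · intro t ht
      have ht0 : 0 ≤ t := ENNReal.toReal_nonneg.trans ht
      have hset : {x | t < (cellMaximal P c w 0 K x).toReal}
          = {x | ENNReal.ofReal t < cellMaximal P c w 0 K x} := by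
        ext x
        exact (ENNReal.ofReal_lt_iff_lt_toReal ht0 (hMtop K x)).symm
      have h := setLIntegral_superlevel_cellMaximal_le (w := w) (η := ENNReal.ofReal (δ - 1)) hc
        hnest hpos hD (by rw [hη]; exact hδw) (t := ENNReal.ofReal t) ENNReal.ofReal_ne_top K
        (fun x => by
          rw [ha0]
          exact (ENNReal.le_ofReal_iff_toReal_le hw' ht0).2 ht)
      simp only [hofReal, hset]
      refine h.trans_eq ?_
      rw [← ENNReal.ofReal_one, ← ENNReal.ofReal_mul (by linarith),
        ← ENNReal.ofReal_add zero_le_one (mul_nonneg (by linarith) (by linarith)),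
        ← ENNReal.ofReal_mul (by nlinarith)]
  have hmono : Monotone fun K x => cellMaximal P c w 0 K x ^ (1 + ε) := fun K L h x =>
    ENNReal.rpow_le_rpow (Finset.sup_mono (Finset.Icc_subset_Icc_right h)) hε1.le
  calc ∫⁻ x, w x ^ (1 + ε) ∂P ≤ ∫⁻ x, ⨆ K, cellMaximal P c w 0 K x ^ (1 + ε) ∂P := by
        refine lintegral_mono_ae ?_
        filter_upwards [ae_le_iSup_cellAverage hc hnest hpos hgen hw hw'] with x hx
        refine (ENNReal.rpow_le_rpow hx hε1.le).trans ?_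
        have h := (ENNReal.orderIsoRpow (1 + ε) hε1).map_iSup fun k => cellAverage P c w k x
        simp only [ENNReal.orderIsoRpow_apply] at h
        rw [h]
        refine iSup_mono fun k => ENNReal.rpow_le_rpow ?_ hε1.le
        exact Finset.le_sup (f := fun i => cellAverage P c w i x) (by simp)
    _ = ⨆ K, ∫⁻ x, cellMaximal P c w 0 K x ^ (1 + ε) ∂P :=
        lintegral_iSup (fun K => (measurable_cellMaximal hc 0 K).pow_const _) hmono
    _ ≤ _ := iSup_le hK

end Partitions

/-! ### Boxes and product partitions. -/

theorem IsBox.measurableSet {n : ℕ} {R : Set (Fin n → ℝ)} (hR : IsBox R) : MeasurableSet R := by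
  obtain ⟨J, hJ, rfl⟩ := hR
  exact MeasurableSet.univ_pi fun i => (hJ i).1.measurableSet

theorem IsBox.isBounded {n : ℕ} {R : Set (Fin n → ℝ)} (hR : IsBox R) : Bornology.IsBounded R := by
  obtain ⟨J, hJ, rfl⟩ := hR
  exact Bornology.IsBounded.pi fun i => (hJ i).2

/-- The partition index of generation `k` on `ℝⁿ`, coordinatewise dyadic with respect to the
distribution functions of the `ν i`. -/
noncomputable def piDyadicIndex {n : ℕ} (ν : Fin n → Measure ℝ) (k : ℕ) (x : Fin n → ℝ) :
    Fin n → ℕ :=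
  fun i => dyadicIndex (ν i) k (x i)

section Product

open ProbabilityTheory

variable {n : ℕ}

theorem cond_pi_eq_pi_cond (μ : Fin n → Measure ℝ) [∀ i, SigmaFinite (μ i)] {J : Fin n → Set ℝ}
    (hJ : ∀ i, MeasurableSet (J i)) (hJ' : ∀ i, μ i (J i) ≠ ∞) :
    (Measure.pi μ)[|Set.univ.pi J] = Measure.pi fun i => (μ i)[|J i] := by
  refine (Measure.pi_eq fun S _ => ?_).symm
  rw [cond_apply (MeasurableSet.univ_pi hJ), ← Set.pi_inter_distrib, Measure.pi_pi,
    Measure.pi_pi, ENNReal.prod_inv_distrib fun i _ j _ _ => Or.inr (hJ' j),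
    ← Finset.prod_mul_distrib]
  exact Finset.prod_congr rfl fun i _ => (cond_apply (hJ i) _ _).symm

theorem piDyadicIndex_cell (ν : Fin n → Measure ℝ) (k : ℕ) (x : Fin n → ℝ) :
    {y | piDyadicIndex ν k y = piDyadicIndex ν k x}
      = Set.univ.pi fun i => {t | dyadicIndex (ν i) k t = dyadicIndex (ν i) k (x i)} := by
  ext y
  simp [piDyadicIndex, funext_iff]

theorem measurable_piDyadicIndex (ν : Fin n → Measure ℝ) (k : ℕ) :
    Measurable (piDyadicIndex ν k) :=
  measurable_pi_lambda _ fun i => (dyadicIndex_mono (ν i) k).measurable.comp (measurable_pi_apply i)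

theorem piDyadicIndex_eq_of_succ (ν : Fin n → Measure ℝ) (k : ℕ) (x y : Fin n → ℝ)
    (h : piDyadicIndex ν (k + 1) x = piDyadicIndex ν (k + 1) y) :
    piDyadicIndex ν k x = piDyadicIndex ν k y := by
  ext i
  have := congrFun h i
  simp only [piDyadicIndex] at this ⊢
  rw [← dyadicIndex_succ_div_two (ν i) k (x i), this, dyadicIndex_succ_div_two]

/-- The sides of a cell are fibres of monotone maps, hence intervals; intersecting with `R` makes
them bounded. -/
theorem isBox_inter_piDyadicIndex_cell (ν : Fin n → Measure ℝ) (k : ℕ) (x : Fin n → ℝ)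
    {R : Set (Fin n → ℝ)} (hR : IsBox R) :
    IsBox ({y | piDyadicIndex ν k y = piDyadicIndex ν k x} ∩ R) := by
  obtain ⟨J, hJ, rfl⟩ := hR
  refine ⟨fun i => {t | dyadicIndex (ν i) k t = dyadicIndex (ν i) k (x i)} ∩ J i, fun i =>
    ⟨Set.OrdConnected.inter ?_ (hJ i).1, (hJ i).2.subset Set.inter_subset_right⟩, ?_⟩
  · exact Set.ordConnected_singleton.preimage_mono (dyadicIndex_mono (ν i) k)
  · rw [piDyadicIndex_cell, Set.pi_inter_distrib]

variable (ν : Fin n → Measure ℝ) [∀ i, IsProbabilityMeasure (ν i)]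
  [∀ i, NullSingletonClass (ν i)]

theorem pi_piDyadicIndex_cell (k : ℕ) (x : Fin n → ℝ) :
    Measure.pi ν {y | piDyadicIndex ν k y = piDyadicIndex ν k x} = ((2 ^ k)⁻¹) ^ n := by
  simp [piDyadicIndex_cell, Measure.pi_pi, measure_dyadicIndex_eq]

/-- Sets that agree almost everywhere with a set of the cell σ-algebra form a σ-algebra, so
coordinate half-spaces suffice, and these reduce to `Iic_ae_eq_iInter_dyadicIndex`. -/
theorem exists_measurableSet_piDyadicIndex_ae_eq (s : Set (Fin n → ℝ)) (hs : MeasurableSet s) :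
    ∃ t, MeasurableSet[⨆ k, MeasurableSpace.pi.comap (piDyadicIndex ν k)] t ∧
      s =ᵐ[Measure.pi ν] t := by
  set m : MeasurableSpace (Fin n → ℝ) :=
    ⨆ k, MeasurableSpace.pi.comap (piDyadicIndex ν k) with hm
  suffices h : MeasurableSpace.pi ≤ eventuallyMeasurableSpace m (ae (Measure.pi ν)) from h s hs
  refine iSup_le fun i => ?_
  have hgen : MeasurableSpace.comap (fun x : Fin n → ℝ => x i) Real.measurableSpace
      = .generateFrom (Set.preimage (fun x : Fin n → ℝ => x i) '' Set.range Set.Iic) := by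
    rw [BorelSpace.measurable_eq (α := ℝ), borel_eq_generateFrom_Iic,
      MeasurableSpace.comap_generateFrom]
  refine hgen.le.trans (MeasurableSpace.generateFrom_le ?_)
  rintro _ ⟨_, ⟨a, rfl⟩, rfl⟩
  refine ⟨(fun x : Fin n → ℝ => x i) ⁻¹'
    ⋂ k, dyadicIndex (ν i) k ⁻¹' Set.Iic (dyadicIndex (ν i) k a), ?_, ?_⟩
  · rw [Set.preimage_iInter]
    refine MeasurableSet.iInter fun k => ?_
    have hk : MeasurableSpace.pi.comap (piDyadicIndex ν k) ≤ m :=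
      le_iSup (fun k => MeasurableSpace.pi.comap (piDyadicIndex ν k)) k
    exact hk _ ⟨{j | j i ≤ dyadicIndex (ν i) k a},
      measurable_pi_apply i measurableSet_Iic, rfl⟩
  · exact (Iic_ae_eq_iInter_dyadicIndex (ν i) a).comp_tendsto Measure.tendsto_eval_ae_ae

end Product

/-! ### Normalised measures, the strong maximal function and the constants. -/

section Weight

open ProbabilityTheory

variable {n : ℕ}

theorem setLAverage_eq_lintegral_cond {Ω : Type*} [MeasurableSpace Ω] (μ : Measure Ω) (R : Set Ω)
    (f : Ω → ℝ≥0∞) : ⨍⁻ x in R, f x ∂μ = ∫⁻ x, f x ∂μ[|R] := by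
  rw [laverage_eq', Measure.restrict_apply_univ, ProbabilityTheory.cond]

theorem setLIntegral_cond {Ω : Type*} [MeasurableSpace Ω] (μ : Measure Ω) {R C : Set Ω}
    (hC : MeasurableSet C) (f : Ω → ℝ≥0∞) :
    ∫⁻ x in C, f x ∂μ[|R] = (μ R)⁻¹ * ∫⁻ x in C ∩ R, f x ∂μ := by
  rw [ProbabilityTheory.cond, Measure.restrict_smul, Measure.restrict_restrict hC,
    lintegral_smul_measure, smul_eq_mul]

theorem setLAverage_cond {Ω : Type*} [MeasurableSpace Ω] (μ : Measure Ω) {R C : Set Ω}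
    (hC : MeasurableSet C) (hR0 : μ R ≠ 0) (hR : μ R ≠ ∞) (f : Ω → ℝ≥0∞) :
    ⨍⁻ x in C, f x ∂μ[|R] = ⨍⁻ x in C ∩ R, f x ∂μ := by
  rw [setLAverage_eq, setLAverage_eq, setLIntegral_cond μ hC, cond_apply' hC, Set.inter_comm R C,
    ENNReal.mul_div_mul_left _ _ (ENNReal.inv_ne_zero.2 hR) (ENNReal.inv_ne_top.2 hR0)]

/-- The Fujii-Wilson condition on a box, multiplied out. -/
theorem setLIntegral_strongMaximal_le {μ : Measure (Fin n → ℝ)} {w : (Fin n → ℝ) → ℝ} {δ : ℝ}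
    (hδ : 0 < δ) (hwδ : strongAInftyConst μ w ≤ ENNReal.ofReal δ) {R : Set (Fin n → ℝ)}
    (hR : IsBox R) (hμR : 0 < μ R) :
    ∫⁻ x in R, strongMaximal μ (R.indicator w) x ∂μ
      ≤ ENNReal.ofReal δ * ∫⁻ x in R, ENNReal.ofReal (w x) ∂μ := by
  rw [← ENNReal.div_le_iff_le_mul (Or.inr ENNReal.ofReal_ne_top)
    (Or.inr (ENNReal.ofReal_pos.2 hδ).ne')]
  refine le_trans ?_ hwδ
  unfold strongAInftyConst
  exact le_iSup_of_le R (le_iSup_of_le hR (le_iSup_of_le hμR le_rfl))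

theorem setLAverage_le_strongMaximal_indicator {μ : Measure (Fin n → ℝ)} {w : (Fin n → ℝ) → ℝ}
    (hw : ∀ x, 0 ≤ w x) {R S : Set (Fin n → ℝ)} (hS : IsBox S) (hμS : 0 < μ S) (hSR : S ⊆ R)
    {x : Fin n → ℝ} (hx : x ∈ S) :
    ⨍⁻ y in S, ENNReal.ofReal (w y) ∂μ ≤ strongMaximal μ (R.indicator w) x := by
  have : ⨍⁻ y in S, ENNReal.ofReal (w y) ∂μ = ⨍⁻ y in S, ‖R.indicator w y‖ₑ ∂μ := by
    rw [setLAverage_eq, setLAverage_eq]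
    congr 1
    refine setLIntegral_congr_fun hS.measurableSet fun y hy => ?_
    rw [Set.indicator_of_mem (hSR hy), Real.enorm_of_nonneg (hw y)]
  rw [this]
  unfold strongMaximal
  exact le_iSup_of_le S (le_iSup_of_le hS (le_iSup_of_le hx (le_iSup_of_le hμS le_rfl)))

theorem mul_lt_one_of_ofReal_lt {n : ℕ} {δ r : ℝ} (hδ : 1 ≤ δ)
    (hrδ : ENNReal.ofReal r < 1 + 1 / (2 ^ n * ENNReal.ofReal (δ - 1))) :
    (r - 1) * (2 ^ n * (δ - 1)) < 1 := by
  rcases hδ.eq_or_lt with rfl | hδ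
  · simp
  have hc : 0 < 2 ^ n * (δ - 1) := mul_pos (by positivity) (by linarith)
  have : (1 : ℝ≥0∞) + 1 / (2 ^ n * ENNReal.ofReal (δ - 1))
      = ENNReal.ofReal (1 + 1 / (2 ^ n * (δ - 1))) := by
    rw [ENNReal.ofReal_add zero_le_one (by positivity), ENNReal.ofReal_div_of_pos hc,
      ENNReal.ofReal_mul (by positivity), ENNReal.ofReal_pow (by norm_num)]
    norm_num
  rw [this, ENNReal.ofReal_lt_ofReal_iff (by positivity)] at hrδ
  rw [← lt_div_iff₀ hc]
  linarith

/-- Since `r' - 1 = 1 / (r - 1)`, this is the constant of the cell inequality with `ε = r - 1` and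
`D = 2 ^ n`. -/
theorem reverseHolderConst_of_ne_one {n : ℕ} {δ r : ℝ} (hr : r ≠ 1) :
    reverseHolderConst n δ r = δ / (1 - (r - 1) * (2 ^ n * (δ - 1))) := by
  have h : r - 1 ≠ 0 := sub_ne_zero.2 hr
  have h1 : r.conjExponent - 1 = 1 / (r - 1) := by
    rw [Real.conjExponent]
    field_simp
    ring
  have h2 : 1 / (r - 1) - 2 ^ n * (δ - 1) = (1 - (r - 1) * (2 ^ n * (δ - 1))) / (r - 1) := by
    field_simp
  rw [reverseHolderConst, if_neg hr, h1, h2, div_div_div_cancel_right₀ h, mul_one_div]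

end Weight

/-! ### The reverse Hölder inequality on a box. -/

/-- The upper bound for `r` is read in `[0, ∞]`, so that it is `∞` for `δ = 1`. -/
theorem corollary4p3 (n : ℕ) (μ : Fin n → Measure ℝ) [∀ i, IsLocallyFiniteMeasure (μ i)]
    [∀ i, NullSingletonClass (μ i)] (w : (Fin n → ℝ) → ℝ) (hw : MemStrongAInfty (Measure.pi μ) w)
    (δ : ℝ) (hδ : 1 ≤ δ) (hwδ : strongAInftyConst (Measure.pi μ) w ≤ ENNReal.ofReal δ)
    (R : Set (Fin n → ℝ)) (hR : IsBox R) (hμR : 0 < Measure.pi μ R)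
    (r : ℝ) (hr : 1 ≤ r)
    (hrδ : ENNReal.ofReal r < 1 + 1 / (2 ^ n * ENNReal.ofReal (δ - 1))) :
    ⨍⁻ x in R, ENNReal.ofReal (w x ^ r) ∂(Measure.pi μ) ≤
      ENNReal.ofReal (reverseHolderConst n δ r) *
        (⨍⁻ x in R, ENNReal.ofReal (w x) ∂(Measure.pi μ)) ^ r := by
  rcases hr.eq_or_lt with rfl | hr
  · simp only [reverseHolderConst, if_true, Real.rpow_one, ENNReal.rpow_one]
    exact le_mul_of_one_le_left' (by simpa using hδ)
  have hRbox := hR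
  have hRm := hR.measurableSet
  have hRtop : Measure.pi μ R ≠ ∞ := hR.isBounded.measure_lt_top.ne
  obtain ⟨J, hJ, rfl⟩ := hR
  set R := Set.univ.pi J with hRdef
  set ν : Fin n → Measure ℝ := fun i => ProbabilityTheory.cond (μ i) (J i) with hν
  have hJ0 : ∀ i, μ i (J i) ≠ 0 := by
    intro i hi
    rw [hRdef, Measure.pi_pi, Finset.prod_eq_zero (Finset.mem_univ i) hi] at hμR
    exact lt_irrefl _ hμR
  have hJtop : ∀ i, μ i (J i) ≠ ∞ := fun i => (hJ i).2.measure_lt_top.ne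
  have : ∀ i, IsProbabilityMeasure (ν i) := fun i =>
    ProbabilityTheory.cond_isProbabilityMeasure_of_finite (hJ0 i) (hJtop i)
  have : ∀ i, NullSingletonClass (ν i) := fun i =>
    ⟨fun x => ProbabilityTheory.cond_absolutelyContinuous (measure_singleton x)⟩
  have hP : ProbabilityTheory.cond (Measure.pi μ) R = Measure.pi ν :=
    cond_pi_eq_pi_cond μ (fun i => (hJ i).1.measurableSet) hJtop
  set c := piDyadicIndex ν with hc
  have hcell := pi_piDyadicIndex_cell ν
  have hcellm : ∀ k x, MeasurableSet {y | c k y = c k x} :=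
    measurableSet_cell (measurable_piDyadicIndex ν)
  have hpos : ∀ k x, Measure.pi ν {y | c k y = c k x} ≠ 0 := fun k x => by
    rw [hcell]
    exact pow_ne_zero _ (ENNReal.inv_ne_zero.2 (ENNReal.pow_ne_top ENNReal.ofNat_ne_top))
  have hμpos : ∀ k x, 0 < Measure.pi μ ({y | c k y = c k x} ∩ R) := fun k x => by
    have h := hpos k x
    rw [← hP, ProbabilityTheory.cond_apply hRm, Set.inter_comm] at h
    exact pos_iff_ne_zero.2 (right_ne_zero_of_mul h)
  have hD : ∀ k x, Measure.pi ν {y | c k y = c k x}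
      ≤ ENNReal.ofReal (2 ^ n) * Measure.pi ν {y | c (k + 1) y = c (k + 1) x} := fun k x => by
    rw [hcell, hcell, ENNReal.ofReal_pow (by norm_num), ENNReal.ofReal_ofNat, ← mul_pow, pow_succ,
      ENNReal.mul_inv (by simp) (by simp), mul_left_comm,
      ENNReal.mul_inv_cancel two_ne_zero ENNReal.ofNat_ne_top, mul_one]
  -- Cells of generation at least `j` through `y` lie in the given cell, so their traces on `R` are
  -- boxes on which the indicator changes nothing.
  have hmax : ∀ j K x, ∀ y ∈ {y | c j y = c j x} ∩ R,
      cellMaximal (Measure.pi ν) c (fun z => ENNReal.ofReal (w z)) j K y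
        ≤ strongMaximal (Measure.pi μ) (({y | c j y = c j x} ∩ R).indicator w) y := by
    intro j K x y hy
    refine Finset.sup_le fun i hi => ?_
    rw [cellAverage, ← hP, setLAverage_cond _ (hcellm i y) hμR.ne' hRtop]
    refine setLAverage_le_strongMaximal_indicator hw.nonneg
      (isBox_inter_piDyadicIndex_cell ν i y hRbox) (hμpos i y) ?_ ⟨rfl, hy.2⟩
    exact fun z hz => ⟨(index_eq_of_le (piDyadicIndex_eq_of_succ ν)
      (Finset.mem_Icc.1 hi).1 hz.1).trans hy.1, hz.2⟩
  have hδw : ∀ j K x, ∫⁻ y in {y | c j y = c j x},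
      cellMaximal (Measure.pi ν) c (fun z => ENNReal.ofReal (w z)) j K y ∂Measure.pi ν
      ≤ ENNReal.ofReal δ * ∫⁻ y in {y | c j y = c j x}, ENNReal.ofReal (w y) ∂Measure.pi ν := by
    intro j K x
    have h := setLIntegral_strongMaximal_le (by linarith) hwδ
      (isBox_inter_piDyadicIndex_cell ν j x hRbox) (hμpos j x)
    have h' := (setLIntegral_mono' ((hcellm j x).inter hRm) (hmax j K x)).trans h
    calc _ = (Measure.pi μ R)⁻¹ * ∫⁻ y in {y | c j y = c j x} ∩ R,
          cellMaximal (Measure.pi ν) c (fun z => ENNReal.ofReal (w z)) j K y ∂Measure.pi μ := by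
          conv_lhs => rw [← hP]
          rw [setLIntegral_cond _ (hcellm j x), hP]
      _ ≤ (Measure.pi μ R)⁻¹ * (ENNReal.ofReal δ *
          ∫⁻ y in {y | c j y = c j x} ∩ R, ENNReal.ofReal (w y) ∂Measure.pi μ) := by
          gcongr
      _ = _ := by
          rw [← hP, setLIntegral_cond _ (hcellm j x)]
          ring
  have hwm : AEMeasurable (fun x => ENNReal.ofReal (w x)) (Measure.pi ν) := by
    rw [← hP]
    exact (hw.locallyIntegrable.aestronglyMeasurable.aemeasurable.ennreal_ofReal).mono_ac
      ProbabilityTheory.cond_absolutelyContinuous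
  have hwint : ∫⁻ x, ENNReal.ofReal (w x) ∂Measure.pi ν ≠ ∞ := by
    rw [← hP, ← setLIntegral_univ, setLIntegral_cond _ MeasurableSet.univ, Set.univ_inter]
    have hint : IntegrableOn w R (Measure.pi μ) :=
      (hw.locallyIntegrable.integrableOn_isCompact hRbox.isBounded.isCompact_closure).mono_set
        subset_closure
    refine ENNReal.mul_ne_top (ENNReal.inv_ne_top.2 hμR.ne') ?_
    exact (hasFiniteIntegral_iff_ofReal (Filter.Eventually.of_forall hw.nonneg)).1 hint.2 |>.ne
  have key := lintegral_rpow_le_of_cells (P := Measure.pi ν) (c := c)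
    (w := fun x => ENNReal.ofReal (w x)) (D := 2 ^ n) (δ := δ) (ε := r - 1)
    (measurable_piDyadicIndex ν) (fun x y => by ext i; simp [hc, piDyadicIndex])
    (piDyadicIndex_eq_of_succ ν) hpos (exists_measurableSet_piDyadicIndex_ae_eq ν)
    (one_le_pow₀ one_le_two) hδ (by linarith) (mul_lt_one_of_ofReal_lt hδ hrδ) hD hδw hwm hwint
  rw [setLAverage_eq_lintegral_cond, setLAverage_eq_lintegral_cond, hP,
    reverseHolderConst_of_ne_one hr.ne']
  rw [add_sub_cancel] at key
  refine le_trans (le_of_eq (lintegral_congr fun x => ?_)) key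
  exact (ENNReal.ofReal_rpow_of_nonneg (hw.nonneg x) (by linarith)).symm
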